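/- Let $\|\cdot\|$ be an arbitrary norm on $\mathbb{R}^d$ and let $T:\mathbb{R}^d\to\mathbb{R}^d$ be nonexpansive, i.e. $\|Tx-Ty\|\le\|x-y\|$ for all $x,y$, with $\mathrm{Fix}(T)=\{x: Tx=x\}\neq\emptyset$. Let $(\beta_n)_{n\ge 1}$ be real numbers with $0<\beta_n<1$ and $\beta_n\to 1$, and put $\beta_0=0$. Let $(U_n)_{n\ge 1}$ be integrable $\mathbb{R}^d$-valued random vectors on a probability space with $\mathbb{E}(U_n)=0$, and put $\sigma_n=\mathbb{E}(\|U_n\|)$. For a deterministic $x^0\in\mathbb{R}^d$, let $(x^n)_n$ be generated by the inexact Halpern iteration $$x^n=(1-\beta_n)x^0+\beta_n\,(Tx^{n-1}+U_n),\qquad n\ge 1.$$ Assume that $$\sum_{n=1}^\infty\sigma_n<\infty,\qquad \sum_{n=1}^\infty(1-\beta_n)=\infty,\qquad \sum_{n=1}^\infty|\beta_n-\beta_{n-1}|<\infty$$ (the last condition holds automatically when $(\beta_n)$ is nondecreasing). Then: (a) Almost surely, $\|x^n-Tx^n\|\to 0$ and every accumulation point of $(x^n)_n$ is a fixed point of $T$.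 (b) If the norm is smooth, in the sense that the limit $\lim_{\lambda\to 0}\frac{\|x+\lambda y\|-\|x\|}{\lambda}$ exists for all $x,y$ with $\|x\|=\|y\|=1$, then there is a (non-random) point $x^*\in\mathrm{Fix}(T)$ such that $x^n\to x^*$ almost surely. -/

import Mathlib

open MeasureTheory Filter Topology

/-- The inexact Halpern iteration anchored at its initial point `x₀`, with error vectors `u n` for `n ≥ 1`:
`x⁰ = x₀` and `xⁿ = (1 - βₙ) x₀ + βₙ (T xⁿ⁻¹ + uₙ)` for `n ≥ 1`
(the values `β 0` and `u 0` are not used). -/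
noncomputable def inexactHalpern {E : Type*} [AddCommGroup E] [Module ℝ E]
    (T : E → E) (β : ℕ → ℝ) (x₀ : E) (u : ℕ → E) : ℕ → E
  | 0 => x₀
  | n + 1 => (1 - β (n + 1)) • x₀ + β (n + 1) • (T (inexactHalpern T β x₀ u n) + u (n + 1))

/-- The norm of `E` is smooth: for all `x`, `y` in the unit sphere, the limit of
`(‖x + t y‖ - ‖x‖) / t` as `t → 0`, `t ≠ 0` (two-sided), exists in `ℝ`. -/
def SmoothNorm (E : Type*) [NormedAddCommGroup E] [NormedSpace ℝ E] : Prop :=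
  ∀ x y : E, ‖x‖ = 1 → ‖y‖ = 1 →
    ∃ l : ℝ, Tendsto (fun t : ℝ => (‖x + t • y‖ - ‖x‖) / t) (𝓝[≠] 0) (𝓝 l)

/-! Since `∑ E‖U n‖ < ∞`, almost every path has summable errors, and the rest is deterministic.
Successive differences contract by factors `β n`, up to summable errors, and `∑ (1 - β n) = ∞`
forces them to zero (`tendsto_zero_of_le_convex_recursion`); asymptotic regularity follows.

For (b), the target `p` is a limit of the anchored points `z = (1 - t) x₀ + t T z` as `t → 1`; it
depends only on `T` and `x₀`, hence is not random. It satisfies `f (x₀ - p) ≥ 0` for some `f`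
supporting `p - q`, for each fixed point `q`. Smoothness makes `f` unique, so this sign passes to
limits of functionals supporting `x n - p`, and `‖x n - p‖ ^ 2` obeys the same kind of recursion. -/

/-! ### Real recursions -/

/-- If `b n ∈ [0, 1]` and `∑ (1 - b n) = ∞`, then `∏ b n = 0`. -/
theorem tendsto_prod_zero_of_tendsto_sum_one_sub {b : ℕ → ℝ} (hb0 : ∀ n, 0 ≤ b n)
    (hsum : Tendsto (fun n => ∑ j ∈ Finset.range n, (1 - b j)) atTop atTop) :
    Tendsto (fun n => ∏ j ∈ Finset.range n, b j) atTop (𝓝 0) := by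
  have hexp : Tendsto (fun n => Real.exp (-∑ j ∈ Finset.range n, (1 - b j))) atTop (𝓝 0) :=
    Real.tendsto_exp_neg_atTop_nhds_zero.comp hsum
  refine squeeze_zero (fun n => Finset.prod_nonneg fun j _ => hb0 j) (fun n => ?_) hexp
  rw [← Finset.sum_neg_distrib, Real.exp_sum]
  refine Finset.prod_le_prod (fun j _ => hb0 j) fun j _ => ?_
  linarith [Real.add_one_le_exp (-(1 - b j))]

theorem tendsto_sum_range_shift {d : ℕ → ℝ} (N : ℕ)
    (h : Tendsto (fun n => ∑ j ∈ Finset.range n, d j) atTop atTop) :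
    Tendsto (fun n => ∑ j ∈ Finset.range n, d (N + j)) atTop atTop := by
  have h1 := tendsto_atTop_add_const_right atTop (-∑ j ∈ Finset.range N, d j)
    ((tendsto_add_atTop_iff_nat N).2 h)
  refine h1.congr fun n => ?_
  rw [add_comm n N, Finset.sum_range_add]
  ring

/-- A nonnegative sequence with `a (n+1) ≤ b n * a n + (1 - b n) * δ n + c n`, where
`∑ (1 - b n) = ∞`, `limsup δ ≤ 0` and `∑ c n < ∞`, tends to zero. -/
theorem tendsto_zero_of_le_convex_recursion {a b c δ : ℕ → ℝ} (ha : ∀ n, 0 ≤ a n)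
    (hb0 : ∀ n, 0 ≤ b n) (hb1 : ∀ n, b n ≤ 1)
    (hsum : Tendsto (fun n => ∑ j ∈ Finset.range n, (1 - b j)) atTop atTop)
    (hδ : ∀ ε > 0, ∀ᶠ n in atTop, δ n ≤ ε) (hc0 : ∀ n, 0 ≤ c n) (hc : Summable c)
    (hrec : ∀ n, a (n + 1) ≤ b n * a n + (1 - b n) * δ n + c n) :
    Tendsto a atTop (𝓝 0) := by
  rw [tendsto_order]
  refine ⟨fun e he => Eventually.of_forall fun n => he.trans_le (ha n), fun e he => ?_⟩
  have hε : 0 < e / 4 := by positivity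
  have htail := (tendsto_order.1 (tendsto_sum_nat_add c)).2 (e / 4) hε
  obtain ⟨N, hN⟩ := eventually_atTop.1 ((hδ _ hε).and htail)
  have hcN : Summable fun j => c (j + N) := (summable_nat_add_iff N).2 hc
  -- The `δ` terms carry weights `1 - b`, so they average to at most `e / 4` instead of
  -- accumulating.
  have hle : ∀ m, a (N + m) ≤ e / 4 + (∏ j ∈ Finset.range m, b (N + j)) * a N
      + ∑ j ∈ Finset.range m, c (j + N) := by
    intro m
    induction m with
    | zero => simp; positivity
    | succ m ih =>
      have h1 := hrec (N + m)
      have hb := hb0 (N + m)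
      have hb' := hb1 (N + m)
      have h2 := mul_le_mul_of_nonneg_left ih hb
      have h3 := mul_le_mul_of_nonneg_left (hN (N + m) (by lia)).1 (sub_nonneg.2 hb')
      have hS : 0 ≤ ∑ j ∈ Finset.range m, c (j + N) := Finset.sum_nonneg fun j _ => hc0 _
      have h4 := mul_le_mul_of_nonneg_right hb' hS
      rw [Finset.prod_range_succ, Finset.sum_range_succ, add_comm m N, ← add_assoc N m 1]
      linarith
  have hprod : Tendsto (fun m => (∏ j ∈ Finset.range m, b (N + j)) * a N) atTop (𝓝 0) := by
    simpa using (tendsto_prod_zero_of_tendsto_sum_one_sub (fun n => hb0 (N + n))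
      (tendsto_sum_range_shift N hsum)).mul_const (a N)
  obtain ⟨M, hM⟩ := eventually_atTop.1 ((tendsto_order.1 hprod).2 (e / 4) hε)
  refine eventually_atTop.2 ⟨N + M, fun n hn => ?_⟩
  obtain ⟨m, rfl⟩ := Nat.exists_eq_add_of_le (show N ≤ n by lia)
  have h1 := hle m
  have h2 := hM m (by lia)
  have h3 := hcN.sum_le_tsum (Finset.range m) fun j _ => hc0 _
  have h4 := (hN N le_rfl).2
  linarith

theorem continuous_of_nonexpansive {E : Type*} [NormedAddCommGroup E] {T : E → E}
    (hT : ∀ x y, ‖T x - T y‖ ≤ ‖x - y‖) : Continuous T :=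
  (LipschitzWith.of_dist_le_mul (K := 1) fun x y => by
    simpa [dist_eq_norm] using hT x y).continuous

theorem isFixedPt_of_tendsto_norm_sub_map {E : Type*} [NormedAddCommGroup E] {T : E → E}
    (hT : ∀ x y, ‖T x - T y‖ ≤ ‖x - y‖) {x : ℕ → E}
    (hx : Tendsto (fun n => ‖x n - T (x n)‖) atTop (𝓝 0)) {p : E}
    (hp : MapClusterPt p atTop x) : T p = p := by
  have hc : Continuous fun y => ‖y - T y‖ :=
    (continuous_id.sub (continuous_of_nonexpansive hT)).norm
  have h : MapClusterPt ‖p - T p‖ atTop fun n => ‖x n - T (x n)‖ :=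
    MapClusterPt.continuousAt_comp (f := fun y => ‖y - T y‖) hc.continuousAt hp
  have h0 : ‖p - T p‖ = 0 := by
    have := ClusterPt.mono h hx
    exact eq_of_nhds_neBot this
  exact (sub_eq_zero.1 (norm_eq_zero.1 h0)).symm

section Halpern

variable {E : Type*} [NormedAddCommGroup E] [NormedSpace ℝ E]

/-! ### Support functionals and smoothness -/

theorem tendsto_clm_apply {x : ℕ → E} {f : ℕ → E →L[ℝ] ℝ} {y : E} {g : E →L[ℝ] ℝ}
    (hf : Tendsto f atTop (𝓝 g)) (hx : Tendsto x atTop (𝓝 y)) :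
    Tendsto (fun n => f n (x n)) atTop (𝓝 (g y)) :=
  (isBoundedBilinearMap_apply.continuous.tendsto (g, y)).comp (hf.prodMk_nhds hx)

/-- The normalized duality map: functionals of norm at most one that support the norm at `x`. -/
def supportFunctionals (x : E) : Set (E →L[ℝ] ℝ) := {f | ‖f‖ ≤ 1 ∧ f x = ‖x‖}

theorem exists_mem_supportFunctionals (x : E) : ∃ f, f ∈ supportFunctionals x := by
  obtain ⟨g, hg, hgx⟩ := exists_dual_vector'' ℝ x
  exact ⟨g, hg, by simpa using hgx⟩

theorem apply_le_of_mem_supportFunctionals {x : E} {f : E →L[ℝ] ℝ}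
    (hf : f ∈ supportFunctionals x) (y : E) : f y ≤ ‖y‖ :=
  (le_abs_self _).trans <| (f.le_of_opNorm_le hf.1 y).trans_eq (one_mul _)

theorem neg_mem_supportFunctionals {x : E} {f : E →L[ℝ] ℝ}
    (hf : f ∈ supportFunctionals x) : -f ∈ supportFunctionals (-x) :=
  ⟨by simpa using hf.1, by simpa using hf.2⟩

theorem supportFunctionals_of_tendsto {x : ℕ → E} {f : ℕ → E →L[ℝ] ℝ} {y : E} {g : E →L[ℝ] ℝ}
    (hf : ∀ n, f n ∈ supportFunctionals (x n)) (hx : Tendsto x atTop (𝓝 y))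
    (hfg : Tendsto f atTop (𝓝 g)) : g ∈ supportFunctionals y :=
  ⟨le_of_tendsto hfg.norm (Eventually.of_forall fun n => (hf n).1),
    tendsto_nhds_unique (tendsto_clm_apply hfg hx) (hx.norm.congr fun n => (hf n).2.symm)⟩

theorem smul_mem_supportFunctionals {x : E} {f : E →L[ℝ] ℝ} {r : ℝ} (hr : 0 ≤ r)
    (hf : f ∈ supportFunctionals x) : f ∈ supportFunctionals (r • x) :=
  ⟨hf.1, by rw [map_smul, hf.2, norm_smul, Real.norm_of_nonneg hr, smul_eq_mul]⟩

/-- `f` is a subgradient of the norm at `x`; dividing by `t > 0` and by `t < 0` gives opposite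
bounds. -/
theorem apply_eq_of_tendsto_norm_quotient {x y : E} {f : E →L[ℝ] ℝ} {l : ℝ}
    (hf : f ∈ supportFunctionals x)
    (hl : Tendsto (fun t : ℝ => (‖x + t • y‖ - ‖x‖) / t) (𝓝[≠] 0) (𝓝 l)) : f y = l := by
  have hsub : ∀ t : ℝ, t * f y ≤ ‖x + t • y‖ - ‖x‖ := fun t => by
    have := apply_le_of_mem_supportFunctionals hf (x + t • y)
    rw [map_add, map_smul, hf.2, smul_eq_mul] at this
    linarith
  refine le_antisymm ?_ ?_
  · refine ge_of_tendsto (hl.mono_left (nhdsGT_le_nhdsNE 0)) ?_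
    filter_upwards [self_mem_nhdsWithin] with t ht
    rw [le_div_iff₀ ht, mul_comm]
    exact hsub t
  · refine le_of_tendsto (hl.mono_left (nhdsLT_le_nhdsNE 0)) ?_
    filter_upwards [self_mem_nhdsWithin] with t ht
    rw [div_le_iff_of_neg ht, mul_comm]
    exact hsub t

theorem SmoothNorm.supportFunctionals_subsingleton (hE : SmoothNorm E) {x : E} (hx : x ≠ 0) :
    (supportFunctionals x).Subsingleton := by
  intro f hf g hg
  have hx' : ‖‖x‖⁻¹ • x‖ = 1 := norm_smul_inv_norm (𝕜 := ℝ) hx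
  have hr : 0 ≤ ‖x‖⁻¹ := by positivity
  ext y
  rcases eq_or_ne y 0 with rfl | hy
  · simp
  obtain ⟨l, hl⟩ := hE (‖x‖⁻¹ • x) (‖y‖⁻¹ • y) hx' (norm_smul_inv_norm (𝕜 := ℝ) hy)
  have h : f (‖y‖⁻¹ • y) = g (‖y‖⁻¹ • y) :=
    (apply_eq_of_tendsto_norm_quotient (smul_mem_supportFunctionals hr hf) hl).trans
      (apply_eq_of_tendsto_norm_quotient (smul_mem_supportFunctionals hr hg) hl).symm
  rw [map_smul, map_smul] at h
  exact smul_right_injective ℝ (inv_ne_zero (norm_ne_zero_iff.2 hy)) h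

variable {T : E → E}

/-! ### Anchored fixed points and the retract -/

theorem exists_anchored_fixedPoint [CompleteSpace E] (hT : ∀ x y, ‖T x - T y‖ ≤ ‖x - y‖)
    (x₀ : E) {t : ℝ} (ht0 : 0 ≤ t) (ht1 : t < 1) : ∃ z, z = (1 - t) • x₀ + t • T z := by
  have hc : ContractingWith ⟨t, ht0⟩ fun z => (1 - t) • x₀ + t • T z := by
    refine ⟨by exact_mod_cast ht1, LipschitzWith.of_dist_le_mul fun x y => ?_⟩
    rw [dist_eq_norm, dist_eq_norm, add_sub_add_left_eq_sub, ← smul_sub, norm_smul,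
      Real.norm_of_nonneg ht0]
    exact mul_le_mul_of_nonneg_left (hT x y) ht0
  exact ⟨_, hc.fixedPoint_isFixedPt.symm⟩

theorem norm_anchored_fixedPoint_sub_le (hT : ∀ x y, ‖T x - T y‖ ≤ ‖x - y‖) {x₀ z q : E} {t : ℝ}
    (ht0 : 0 ≤ t) (ht1 : t < 1) (hz : z = (1 - t) • x₀ + t • T z) (hq : T q = q) :
    ‖z - q‖ ≤ ‖x₀ - q‖ := by
  have h : z - q = (1 - t) • (x₀ - q) + t • (T z - T q) := by
    rw [hq]; nth_rewrite 1 [hz]; module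
  have h1 : ‖z - q‖ ≤ (1 - t) * ‖x₀ - q‖ + t * ‖z - q‖ := by
    calc ‖z - q‖ = ‖(1 - t) • (x₀ - q) + t • (T z - T q)‖ := by rw [← h]
      _ ≤ (1 - t) * ‖x₀ - q‖ + t * ‖T z - T q‖ := by
        refine (norm_add_le _ _).trans_eq ?_
        rw [norm_smul, norm_smul, Real.norm_of_nonneg ht0, Real.norm_of_nonneg (by linarith)]
      _ ≤ _ := by gcongr; exact hT z q
  have h2 : (1 - t) * ‖z - q‖ ≤ (1 - t) * ‖x₀ - q‖ := by linarith
  exact le_of_mul_le_mul_left h2 (by linarith)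

/-- `x₀ - z` is a nonnegative multiple of `(z - T z) - (q - T q)`, and `I - T` is accretive. -/
theorem apply_anchored_fixedPoint_nonneg (hT : ∀ x y, ‖T x - T y‖ ≤ ‖x - y‖) {x₀ z q : E} {t : ℝ}
    (ht0 : 0 ≤ t) (ht1 : t < 1) (hz : z = (1 - t) • x₀ + t • T z) (hq : T q = q)
    {f : E →L[ℝ] ℝ} (hf : f ∈ supportFunctionals (z - q)) : 0 ≤ f (x₀ - z) := by
  have h : (1 - t) • (x₀ - z) = t • ((z - q) - (T z - T q)) := by
    rw [hq]
    have : (1 - t) • x₀ = z - t • T z := by nth_rewrite 1 [hz]; module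
    rw [smul_sub, this]; module
  have h1 : (1 - t) * f (x₀ - z) = t * (‖z - q‖ - f (T z - T q)) := by
    have := congrArg f h
    rwa [map_smul, map_smul, map_sub f (z - q), hf.2, smul_eq_mul, smul_eq_mul] at this
  have h2 := (apply_le_of_mem_supportFunctionals hf (T z - T q)).trans (hT z q)
  exact nonneg_of_mul_nonneg_right (h1 ▸ mul_nonneg ht0 (sub_nonneg.2 h2)) (by linarith)

/-- The point `p` is the sunny nonexpansive retract of `x₀` onto the fixed point set. -/
theorem exists_fixedPoint_forall_support_nonneg [FiniteDimensional ℝ E]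
    (hT : ∀ x y, ‖T x - T y‖ ≤ ‖x - y‖) (hFix : ∃ p, T p = p) (x₀ : E) :
    ∃ p, T p = p ∧ ∀ q, T q = q → ∃ f ∈ supportFunctionals (p - q), 0 ≤ f (x₀ - p) := by
  have : CompleteSpace E := FiniteDimensional.complete ℝ E
  have : ProperSpace E := FiniteDimensional.proper ℝ E
  have : ProperSpace (E →L[ℝ] ℝ) := FiniteDimensional.proper ℝ _
  obtain ⟨r, hr⟩ := hFix
  let s : ℕ → ℝ := fun n => 1 / ((n : ℝ) + 1)
  have hs0 : ∀ n, 0 < s n := fun n => Nat.one_div_pos_of_nat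
  have hs1 : ∀ n, s n ≤ 1 := fun n => by
    have := Nat.one_div_le_one_div (α := ℝ) (Nat.zero_le n)
    simpa [s] using this
  choose z hz using fun n => exists_anchored_fixedPoint hT x₀ (t := 1 - s n)
    (by linarith [hs1 n]) (by linarith [hs0 n])
  have hzq : ∀ q, T q = q → ∀ n, ‖z n - q‖ ≤ ‖x₀ - q‖ := fun q hq n =>
    norm_anchored_fixedPoint_sub_le hT (by linarith [hs1 n]) (by linarith [hs0 n]) (hz n) hq
  obtain ⟨p, -, φ, hφ, hp⟩ := tendsto_subseq_of_bounded
    (Metric.isBounded_closedBall (x := r) (r := ‖x₀ - r‖))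
    fun n => mem_closedBall_iff_norm.2 (hzq r hr n)
  have hTp : Tendsto (fun n => T (z (φ n))) atTop (𝓝 (T p)) :=
    ((continuous_of_nonexpansive hT).tendsto p).comp hp
  have hsφ : Tendsto (fun n => s (φ n)) atTop (𝓝 0) :=
    tendsto_one_div_add_atTop_nhds_zero_nat.comp hφ.tendsto_atTop
  refine ⟨p, ?_, fun q hq => ?_⟩
  · have hlim : Tendsto (fun n => (1 - (1 - s (φ n))) • x₀ + (1 - s (φ n)) • T (z (φ n))) atTop
        (𝓝 ((1 - (1 - (0 : ℝ))) • x₀ + (1 - (0 : ℝ)) • T p)) :=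
      ((tendsto_const_nhds.sub (tendsto_const_nhds.sub hsφ)).smul_const x₀).add
        ((tendsto_const_nhds.sub hsφ).smul hTp)
    have h := tendsto_nhds_unique (hlim.congr fun n => (hz (φ n)).symm) hp
    simpa using h
  -- The subsequence `ψ` may depend on `q`; `p` was fixed beforehand along `φ`.
  · choose f hf using fun n => exists_mem_supportFunctionals (z (φ n) - q)
    obtain ⟨g, -, ψ, hψ, hg⟩ := tendsto_subseq_of_bounded
      (Metric.isBounded_closedBall (x := (0 : E →L[ℝ] ℝ)) (r := 1))
      fun n => mem_closedBall_zero_iff.2 (hf n).1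
    have hpψ : Tendsto (fun n => z (φ (ψ n))) atTop (𝓝 p) := hp.comp hψ.tendsto_atTop
    refine ⟨g, supportFunctionals_of_tendsto (fun n => hf (ψ n)) (hpψ.sub_const q) hg, ?_⟩
    refine ge_of_tendsto' (tendsto_clm_apply hg (hpψ.const_sub x₀)) fun n => ?_
    exact apply_anchored_fixedPoint_nonneg hT (by linarith [hs1 (φ (ψ n))])
      (by linarith [hs0 (φ (ψ n))]) (hz _) hq (hf _)

/-! ### Boundedness and asymptotic regularity -/

theorem tendsto_sum_range_one_sub_succ {β : ℕ → ℝ}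
    (h : Tendsto (fun n : ℕ => ∑ j ∈ Finset.Icc 1 n, (1 - β j)) atTop atTop) :
    Tendsto (fun n => ∑ j ∈ Finset.range n, (1 - β (j + 1))) atTop atTop := by
  refine h.congr fun n => ?_
  rw [Finset.range_eq_Ico, Finset.sum_Ico_add' (fun j => 1 - β j) 0 n 1]
  rfl

variable {β : ℕ → ℝ} {x₀ : E} {u : ℕ → E}

theorem norm_inexactHalpern_sub_le (hT : ∀ x y, ‖T x - T y‖ ≤ ‖x - y‖)
    (hβ : ∀ n : ℕ, 1 ≤ n → 0 < β n ∧ β n < 1) {q : E} (hq : T q = q) (n : ℕ) :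
    ‖inexactHalpern T β x₀ u n - q‖ ≤ ‖x₀ - q‖ + ∑ k ∈ Finset.range n, ‖u (k + 1)‖ := by
  induction n with
  | zero => simp [inexactHalpern]
  | succ n ih =>
    obtain ⟨h0, h1⟩ := hβ (n + 1) (by lia)
    have hS : 0 ≤ ∑ k ∈ Finset.range n, ‖u (k + 1)‖ := Finset.sum_nonneg fun _ _ => norm_nonneg _
    set y := inexactHalpern T β x₀ u n
    have h : inexactHalpern T β x₀ u (n + 1) - q
        = (1 - β (n + 1)) • (x₀ - q) + β (n + 1) • ((T y - T q) + u (n + 1)) := by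
      rw [inexactHalpern, hq]; module
    rw [h, Finset.sum_range_succ]
    calc _ ≤ (1 - β (n + 1)) * ‖x₀ - q‖ + β (n + 1) * (‖T y - T q‖ + ‖u (n + 1)‖) := by
          refine (norm_add_le _ _).trans ?_
          rw [norm_smul, norm_smul, Real.norm_of_nonneg h0.le, Real.norm_of_nonneg (by linarith)]
          gcongr
          exact norm_add_le _ _
      _ ≤ (1 - β (n + 1)) * ‖x₀ - q‖ + β (n + 1) *
            (‖x₀ - q‖ + ∑ k ∈ Finset.range n, ‖u (k + 1)‖ + ‖u (n + 1)‖) := by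
          gcongr; exact (hT y q).trans ih
      _ ≤ _ := by
          have := mul_le_mul_of_nonneg_right h1.le (add_nonneg hS (norm_nonneg (u (n + 1))))
          linarith

theorem exists_norm_inexactHalpern_sub_le (hT : ∀ x y, ‖T x - T y‖ ≤ ‖x - y‖)
    (hβ : ∀ n : ℕ, 1 ≤ n → 0 < β n ∧ β n < 1) (hu : Summable fun n => ‖u (n + 1)‖)
    {q : E} (hq : T q = q) :
    ∃ C, 0 ≤ C ∧ ‖x₀ - q‖ ≤ C ∧ ∀ n, ‖inexactHalpern T β x₀ u n - q‖ ≤ C := by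
  have h : 0 ≤ ∑' k, ‖u (k + 1)‖ := tsum_nonneg fun _ => norm_nonneg _
  refine ⟨‖x₀ - q‖ + ∑' k, ‖u (k + 1)‖, by positivity, by linarith, fun n => ?_⟩
  exact (norm_inexactHalpern_sub_le hT hβ hq n).trans
    (by gcongr; exact hu.sum_le_tsum _ fun _ _ => norm_nonneg _)

theorem tendsto_norm_inexactHalpern_succ_sub (hT : ∀ x y, ‖T x - T y‖ ≤ ‖x - y‖)
    (hFix : ∃ p, T p = p) (hβ : ∀ n : ℕ, 1 ≤ n → 0 < β n ∧ β n < 1)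
    (hβ_div : Tendsto (fun n : ℕ => ∑ j ∈ Finset.Icc 1 n, (1 - β j)) atTop atTop)
    (hβ_var : Summable (fun n : ℕ => β (n + 1) - β n))
    (hu : Summable fun n => ‖u (n + 1)‖) :
    Tendsto (fun n => ‖inexactHalpern T β x₀ u (n + 1) - inexactHalpern T β x₀ u n‖)
      atTop (𝓝 0) := by
  obtain ⟨q, hq⟩ := hFix
  obtain ⟨C, hC0, hC1, hC⟩ := exists_norm_inexactHalpern_sub_le (x₀ := x₀) hT hβ hu hq
  set x := inexactHalpern T β x₀ u with hxdef
  refine tendsto_zero_of_le_convex_recursion (b := fun n => β (n + 2)) (δ := fun _ => 0)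
    (c := fun n => |β (n + 2) - β (n + 1)| * (2 * C) + (‖u (n + 2)‖ + ‖u (n + 1)‖))
    (fun n => norm_nonneg _) (fun n => (hβ _ (by lia)).1.le) (fun n => (hβ _ (by lia)).2.le)
    ?_ (fun ε hε => Eventually.of_forall fun _ => hε.le) (fun n => by positivity) ?_ fun n => ?_
  · have := tendsto_sum_range_shift 1 (tendsto_sum_range_one_sub_succ hβ_div)
    refine this.congr fun n => Finset.sum_congr rfl fun j _ => ?_
    rw [add_comm 1 j]
  · refine Summable.add (Summable.mul_right _ ?_) (Summable.add ?_ hu)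
    -- Summability in `ℝ` is absolute; the shift removes the term with `β 0`.
    · exact ((summable_nat_add_iff 1).2 hβ_var).abs
    · exact (summable_nat_add_iff 1).2 hu
  · obtain ⟨h0, h1⟩ := hβ (n + 1) (by lia)
    obtain ⟨h0', h1'⟩ := hβ (n + 2) (by lia)
    -- Inserting `T q = q` shows that the change in `β` multiplies a vector of norm at most `2 * C`.
    have hx : x (n + 1 + 1) - x (n + 1) = (β (n + 2) - β (n + 1)) • ((T (x n) - T q) - (x₀ - q))
        + β (n + 2) • (T (x (n + 1)) - T (x n)) + (β (n + 2) • u (n + 2) - β (n + 1) • u (n + 1)) := by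
      have e1 : x (n + 1 + 1) = (1 - β (n + 2)) • x₀ + β (n + 2) • (T (x (n + 1)) + u (n + 2)) := rfl
      have e2 : x (n + 1) = (1 - β (n + 1)) • x₀ + β (n + 1) • (T (x n) + u (n + 1)) := rfl
      rw [e1]
      nth_rewrite 2 [e2]
      rw [hq]; module
    rw [hx]
    have b1 : ‖(β (n + 2) - β (n + 1)) • ((T (x n) - T q) - (x₀ - q))‖
        ≤ |β (n + 2) - β (n + 1)| * (2 * C) := by
      rw [norm_smul, Real.norm_eq_abs]
      gcongr
      linarith [norm_sub_le (T (x n) - T q) (x₀ - q), hT (x n) q, hC n]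
    have b2 : ‖β (n + 2) • (T (x (n + 1)) - T (x n))‖ ≤ β (n + 2) * ‖x (n + 1) - x n‖ := by
      rw [norm_smul, Real.norm_of_nonneg h0'.le]
      gcongr; exact hT _ _
    have b3 : ‖β (n + 2) • u (n + 2) - β (n + 1) • u (n + 1)‖ ≤ ‖u (n + 2)‖ + ‖u (n + 1)‖ := by
      refine (norm_sub_le _ _).trans ?_
      rw [norm_smul, norm_smul, Real.norm_of_nonneg h0.le, Real.norm_of_nonneg h0'.le]
      exact add_le_add (mul_le_of_le_one_left (norm_nonneg _) h1'.le)
        (mul_le_of_le_one_left (norm_nonneg _) h1.le)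
    refine norm_add₃_le.trans ?_
    linarith

theorem tendsto_norm_inexactHalpern_sub_map (hT : ∀ x y, ‖T x - T y‖ ≤ ‖x - y‖)
    (hFix : ∃ p, T p = p) (hβ : ∀ n : ℕ, 1 ≤ n → 0 < β n ∧ β n < 1)
    (hβ_lim : Tendsto β atTop (𝓝 1))
    (hβ_div : Tendsto (fun n : ℕ => ∑ j ∈ Finset.Icc 1 n, (1 - β j)) atTop atTop)
    (hβ_var : Summable (fun n : ℕ => β (n + 1) - β n))
    (hu : Summable fun n => ‖u (n + 1)‖) :
    Tendsto (fun n => ‖inexactHalpern T β x₀ u n - T (inexactHalpern T β x₀ u n)‖)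
      atTop (𝓝 0) := by
  have hreg := tendsto_norm_inexactHalpern_succ_sub (x₀ := x₀) hT hFix hβ hβ_div hβ_var hu
  obtain ⟨q, hq⟩ := hFix
  obtain ⟨C, hC0, hC1, hC⟩ := exists_norm_inexactHalpern_sub_le (x₀ := x₀) hT hβ hu hq
  set x := inexactHalpern T β x₀ u with hxdef
  have hb : Tendsto (fun n => (1 - β (n + 1)) * (2 * C)) atTop (𝓝 0) := by
    simpa using (((tendsto_add_atTop_iff_nat 1).2 hβ_lim).const_sub 1).mul_const (2 * C)
  have hlim := (hreg.add hb).add hu.tendsto_atTop_zero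
  rw [add_zero, add_zero] at hlim
  refine squeeze_zero (fun n => norm_nonneg _) (fun n => ?_) hlim
  obtain ⟨h0, h1⟩ := hβ (n + 1) (by lia)
  have hx : x n - T (x n) = -(x (n + 1) - x n) + (1 - β (n + 1)) • ((x₀ - q) - (T (x n) - T q))
      + β (n + 1) • u (n + 1) := by
    have e2 : x (n + 1) = (1 - β (n + 1)) • x₀ + β (n + 1) • (T (x n) + u (n + 1)) := rfl
    rw [e2, hq]; module
  rw [hx]
  refine (norm_add₃_le).trans ?_
  rw [norm_neg, norm_smul, norm_smul, Real.norm_of_nonneg h0.le, Real.norm_of_nonneg (by linarith)]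
  gcongr
  · linarith [norm_sub_le (x₀ - q) (T (x n) - T q), hT (x n) q, hC n]
  · exact mul_le_of_le_one_left (norm_nonneg _) h1.le

/-! ### Convergence for smooth norms -/

/-- For a smooth norm the sunny retract `p` attracts the functionals supporting `x n - p`. -/
theorem eventually_norm_mul_support_le [FiniteDimensional ℝ E] (hE : SmoothNorm E)
    (hT : ∀ x y, ‖T x - T y‖ ≤ ‖x - y‖) {p : E}
    (hp : ∀ q, T q = q → ∃ f ∈ supportFunctionals (p - q), 0 ≤ f (x₀ - p))
    {x : ℕ → E} {C : ℝ} (hC : ∀ n, ‖x n - p‖ ≤ C)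
    (hx : Tendsto (fun n => ‖x n - T (x n)‖) atTop (𝓝 0)) {f : ℕ → E →L[ℝ] ℝ}
    (hf : ∀ n, f n ∈ supportFunctionals (x n - p)) {ε : ℝ} (hε : 0 < ε) :
    ∀ᶠ n in atTop, ‖x n - p‖ * f n (x₀ - p) ≤ ε := by
  have : ProperSpace E := FiniteDimensional.proper ℝ E
  have : ProperSpace (E →L[ℝ] ℝ) := FiniteDimensional.proper ℝ _
  by_contra hcon
  obtain ⟨φ, hφ, hφε⟩ := extraction_of_frequently_atTop (not_eventually.1 hcon)
  obtain ⟨⟨q, g⟩, -, ψ, hψ, hlim⟩ := tendsto_subseq_of_bounded (x := fun n => (x (φ n), f (φ n)))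
    ((Metric.isBounded_closedBall (x := p) (r := C)).prod
      (Metric.isBounded_closedBall (x := (0 : E →L[ℝ] ℝ)) (r := 1)))
    fun n => ⟨mem_closedBall_iff_norm.2 (hC _), mem_closedBall_zero_iff.2 (hf _).1⟩
  obtain ⟨hq, hg⟩ := (Prod.tendsto_iff _ _).1 hlim
  have hsub : Tendsto (fun n => φ (ψ n)) atTop atTop := hφ.tendsto_atTop.comp hψ.tendsto_atTop
  have hTq : T q = q := isFixedPt_of_tendsto_norm_sub_map hT hx
    (hq.mapClusterPt.of_comp hsub)
  have hgq : g ∈ supportFunctionals (q - p) :=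
    supportFunctionals_of_tendsto (fun n => hf (φ (ψ n))) (hq.sub_const p) hg
  have hge : ε ≤ ‖q - p‖ * g (x₀ - p) :=
    ge_of_tendsto' ((hq.sub_const p).norm.mul (tendsto_clm_apply hg tendsto_const_nhds))
      fun n => (not_le.1 (hφε (ψ n))).le
  -- At `q = p` supports are not unique, but there the factor `‖x n - p‖` tends to zero.
  rcases eq_or_ne p q with rfl | hpq
  · simp only [sub_self, norm_zero, zero_mul] at hge
    linarith
  · obtain ⟨h, hh, hh0⟩ := hp q hTq
    -- By uniqueness `-g` is the functional given by `hp`, so `g (x₀ - p) ≤ 0`.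
    have hneg := neg_mem_supportFunctionals hgq
    rw [neg_sub] at hneg
    rw [hE.supportFunctionals_subsingleton (sub_ne_zero.2 hpq) hh hneg] at hh0
    have hg0 : g (x₀ - p) ≤ 0 := by simpa using hh0
    linarith [mul_nonpos_of_nonneg_of_nonpos (norm_nonneg (q - p)) hg0]

theorem tendsto_inexactHalpern_of_smoothNorm [FiniteDimensional ℝ E] (hE : SmoothNorm E)
    (hT : ∀ x y, ‖T x - T y‖ ≤ ‖x - y‖) (hβ : ∀ n : ℕ, 1 ≤ n → 0 < β n ∧ β n < 1)
    (hβ_lim : Tendsto β atTop (𝓝 1))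
    (hβ_div : Tendsto (fun n : ℕ => ∑ j ∈ Finset.Icc 1 n, (1 - β j)) atTop atTop)
    (hβ_var : Summable (fun n : ℕ => β (n + 1) - β n))
    (hu : Summable fun n => ‖u (n + 1)‖) {p : E} (hTp : T p = p)
    (hp : ∀ q, T q = q → ∃ f ∈ supportFunctionals (p - q), 0 ≤ f (x₀ - p)) :
    Tendsto (inexactHalpern T β x₀ u) atTop (𝓝 p) := by
  have hreg := tendsto_norm_inexactHalpern_sub_map (x₀ := x₀) hT ⟨p, hTp⟩ hβ hβ_lim hβ_div
    hβ_var hu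
  obtain ⟨C, hC0, hC1, hC⟩ := exists_norm_inexactHalpern_sub_le (x₀ := x₀) hT hβ hu hTp
  set x := inexactHalpern T β x₀ u with hxdef
  choose f hf using fun n => exists_mem_supportFunctionals (x n - p)
  have hsq : Tendsto (fun n => ‖x n - p‖ ^ 2) atTop (𝓝 0) := by
    refine tendsto_zero_of_le_convex_recursion (b := fun n => β (n + 1))
      (δ := fun n => 2 * (‖x (n + 1) - p‖ * f (n + 1) (x₀ - p)))
      (c := fun n => 2 * C * ‖u (n + 1)‖)
      (fun n => by positivity) (fun n => (hβ _ (by lia)).1.le) (fun n => (hβ _ (by lia)).2.le)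
      (tendsto_sum_range_one_sub_succ hβ_div) (fun ε hε => ?_) (fun n => by positivity)
      (hu.mul_left _) fun n => ?_
    · have h := eventually_norm_mul_support_le hE hT hp hC hreg hf (half_pos hε)
      filter_upwards [(tendsto_add_atTop_nat 1).eventually h] with n hn
      linarith
    · obtain ⟨h0, h1⟩ := hβ (n + 1) (by lia)
      have e : x (n + 1) - p = (1 - β (n + 1)) • (x₀ - p) + β (n + 1) • (T (x n) - T p)
          + β (n + 1) • u (n + 1) := by
        have e2 : x (n + 1) = (1 - β (n + 1)) • x₀ + β (n + 1) • (T (x n) + u (n + 1)) := rfl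
        rw [e2, hTp]; module
      have hF := (hf (n + 1)).2
      set F := f (n + 1)
      have h2 : F (x (n + 1) - p) = (1 - β (n + 1)) * F (x₀ - p) + β (n + 1) * F (T (x n) - T p)
          + β (n + 1) * F (u (n + 1)) := by
        rw [e]; simp only [map_add, map_smul, smul_eq_mul]
      have h3 : F (T (x n) - T p) ≤ ‖x n - p‖ :=
        (apply_le_of_mem_supportFunctionals (hf (n + 1)) _).trans (hT _ _)
      have h4 : F (u (n + 1)) ≤ ‖u (n + 1)‖ := apply_le_of_mem_supportFunctionals (hf (n + 1)) _
      have hCn := hC (n + 1)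
      rw [hF] at h2
      have hA : 0 ≤ ‖x (n + 1) - p‖ := norm_nonneg _
      have hw := norm_nonneg (u (n + 1))
      generalize ‖x (n + 1) - p‖ = A at *
      generalize ‖x n - p‖ = B at *
      -- Multiplying `h2` by `A` and using `2AB ≤ A² + B²` leaves `(2 - β) A²` on the left, with `2
      -- - β ≥ 1`; hence the factors 2 in `δ` and `c`.
      have h5 := mul_le_mul_of_nonneg_left h3 (mul_nonneg hA h0.le)
      have h6 := mul_le_mul_of_nonneg_left h4 (mul_nonneg hA h0.le)
      have h7 := mul_le_mul_of_nonneg_right (mul_le_of_le_one_right hA h1.le) hw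
      have h8 := mul_le_mul_of_nonneg_right hCn hw
      have h9 := mul_nonneg h0.le (sq_nonneg (A - B))
      have h10 := mul_nonneg (sub_nonneg.2 h1.le) (sq_nonneg A)
      have h11 : A * A = A * ((1 - β (n + 1)) * F (x₀ - p) + β (n + 1) * F (T (x n) - T p)
          + β (n + 1) * F (u (n + 1))) := by rw [← h2]
      linarith
  have := hsq.sqrt
  simp only [Real.sqrt_zero, Real.sqrt_sq (norm_nonneg _)] at this
  exact tendsto_iff_norm_sub_tendsto_zero.2 this

end Halpern

/-! ### Passage to random errors -/

theorem ae_summable_norm_of_summable_integral_norm {E Ω : Type*} [NormedAddCommGroup E]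
    [MeasurableSpace Ω] {μ : Measure Ω} {V : ℕ → Ω → E} (hV : ∀ n, Integrable (V n) μ)
    (hsum : Summable fun n => ∫ ω, ‖V n ω‖ ∂μ) : ∀ᵐ ω ∂μ, Summable fun n => ‖V n ω‖ := by
  have hmeas : ∀ n, AEMeasurable (fun ω => ‖V n ω‖ₑ) μ := fun n => (hV n).1.enorm
  have hfin : ∫⁻ ω, ∑' n, ‖V n ω‖ₑ ∂μ ≠ ⊤ := by
    rw [lintegral_tsum hmeas]
    simp_rw [← fun n => ofReal_integral_norm_eq_lintegral_enorm (hV n)]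
    exact hsum.tsum_ofReal_ne_top
  filter_upwards [ae_lt_top' (AEMeasurable.tsum hmeas) hfin] with ω hω
  have := ENNReal.summable_toReal hω.ne
  simpa using this

theorem theorem3
    {E : Type*} [NormedAddCommGroup E] [NormedSpace ℝ E] [FiniteDimensional ℝ E]
    {Ω : Type*} [MeasurableSpace Ω] (P : Measure Ω) [IsProbabilityMeasure P]
    (T : E → E) (hT : ∀ x y : E, ‖T x - T y‖ ≤ ‖x - y‖)
    (hFix : ∃ p : E, T p = p)
    (β : ℕ → ℝ) (hβ : ∀ n : ℕ, 1 ≤ n → 0 < β n ∧ β n < 1)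
    (hβ_lim : Tendsto β atTop (𝓝 1))
    (hβ_div : Tendsto (fun n : ℕ => ∑ j ∈ Finset.Icc 1 n, (1 - β j)) atTop atTop)
    (hβ_var : Summable (fun n : ℕ => β (n + 1) - β n))
    (U : ℕ → Ω → E) (hU_int : ∀ n : ℕ, 1 ≤ n → Integrable (U n) P)
    (hU_mean : ∀ n : ℕ, 1 ≤ n → ∫ ω, U n ω ∂P = 0)
    (hU_sum : Summable (fun n : ℕ => ∫ ω, ‖U (n + 1) ω‖ ∂P))
    (x₀ : E) (x : ℕ → Ω → E)
    (hx : ∀ (n : ℕ) (ω : Ω), x n ω = inexactHalpern T β x₀ (fun k => U k ω) n) :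
    ((∀ᵐ ω ∂P, Tendsto (fun n : ℕ => ‖x n ω - T (x n ω)‖) atTop (𝓝 0)) ∧
      (∀ᵐ ω ∂P, ∀ p : E, MapClusterPt p atTop (fun n : ℕ => x n ω) → T p = p)) ∧
    (SmoothNorm E →
      ∃ p : E, T p = p ∧
        ∀ᵐ ω ∂P, Tendsto (fun n : ℕ => x n ω) atTop (𝓝 p)) := by
  obtain rfl : x = fun n ω => inexactHalpern T β x₀ (fun k => U k ω) n :=
    funext fun n => funext fun ω => hx n ω
  have hu : ∀ᵐ ω ∂P, Summable fun n => ‖U (n + 1) ω‖ :=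
    ae_summable_norm_of_summable_integral_norm (fun n => hU_int (n + 1) (by lia)) hU_sum
  have hreg : ∀ᵐ ω ∂P, Tendsto (fun n => ‖inexactHalpern T β x₀ (fun k => U k ω) n -
      T (inexactHalpern T β x₀ (fun k => U k ω) n)‖) atTop (𝓝 0) := by
    filter_upwards [hu] with ω hω
    exact tendsto_norm_inexactHalpern_sub_map hT hFix hβ hβ_lim hβ_div hβ_var hω
  refine ⟨⟨hreg, ?_⟩, fun hE => ?_⟩
  · filter_upwards [hreg] with ω hω p hp
    exact isFixedPt_of_tendsto_norm_sub_map hT hω hp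
  · obtain ⟨p, hTp, hp⟩ := exists_fixedPoint_forall_support_nonneg hT hFix x₀
    refine ⟨p, hTp, ?_⟩
    filter_upwards [hu] with ω hω
    exact tendsto_inexactHalpern_of_smoothNorm hE hT hβ hβ_lim hβ_div hβ_var hω hTp hp
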